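/- Let $M$ be a loopless matroid on a finite ground set $E$, with lattice of flats $L(M)$ (ordered by inclusion, with joins $X\vee Y=\overline{X\cup Y}$). Write $e_X=\sum_{i\in X}e_i\in\mathbb R^E$ for $X\subseteq E$, and let $N_{\mathbb R}=\mathbb R^E/\mathbb R\,e_E$. A matroid is connected if it is not a direct sum of two matroids with nonempty ground sets. Let $G_{\min}=L_{\mathrm{irr}}(M)$ be the set of flats $X\neq\overline{\emptyset}$ of $M$ for which the restriction $M|X$ is connected. A subset $S\subseteq G_{\min}$ is nested if, for any $k\ge 2$ pairwise incomparable (distinct) elements $X_1,\dots,X_k$ of $S$, the join $X_1\vee\dots\vee X_k$ is not in $G_{\min}$. For a nested set $S$ let $\sigma_S\subseteq N_{\mathbb R}$ be the cone of all nonnegative linear combinations of the classes of the vectors $e_X$, $X\in S$ (so $\sigma_\emptyset=\{0\}$), and let the nested set fan be $\Sigma(M,G_{\min})=\{\sigma_S : S\text{ nested}\}$. Let $P_M=\mathrm{conv}\{e_B : B\text{ a basis of }M\}\subseteq\mathbb R^E$ be the matroid polytope. For $u\in\mathbb R^E$ let $F_u$ be the face of $P_M$ on which the linear functional $u$ attains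 its maximum, let $\sigma_u\subseteq N_{\mathbb R}$ be the corresponding cone of the outer normal fan of $P_M$, i.e. the set of classes of all $v\in\mathbb R^E$ with $F_u\subseteq F_v$, and let $M_u$ be the matroid on $E$ whose bases are the bases $B$ of $M$ with $e_B\in F_u$. The Bergman fan is $\mathcal B(M)=\{\sigma_u : u\in\mathbb R^E,\ M_u\text{ has no loops}\}$. Theorem. The nested set fan $\Sigma(M,G_{\min})$ refines the Bergman fan $\mathcal B(M)$: every cone of $\Sigma(M,G_{\min})$ is contained in a cone of $\mathcal B(M)$, and the two families of cones have the same support, $$\bigcup_{\sigma\in\Sigma(M,G_{\min})}\sigma=\bigcup_{\tau\in\mathcal B(M)}\tau .$$ -/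

import Mathlib

namespace BergmanNested

noncomputable section

/-! ### Connected matroids, irreducible flats, nested sets -/

/-- A matroid is connected if it is not the direct sum of two matroids
with nonempty ground sets. -/
def IsConnected {α : Type*} (M : Matroid α) : Prop :=
  ¬ ∃ (M₁ M₂ : Matroid α) (h : Disjoint M₁.E M₂.E),
    M₁.E.Nonempty ∧ M₂.E.Nonempty ∧ M = M₁.disjointSum M₂ h

/-- The minimal building set `G_min = L_irr(M)` of the lattice of flats: the flats `X`, different
from the least flat `cl(∅)`, such that the restriction `M|X` is connected. -/
def minBuildingSet {α : Type*} (M : Matroid α) : Set (Set α) :=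
  {X | M.IsFlat X ∧ X ≠ M.closure ∅ ∧ IsConnected (M.restrict X)}

/-- `S` is a nested set for the set `G` of flats of `M`: it is a subset of `G`, and the join
(in the lattice of flats) of two or more pairwise incomparable members of `S` is never in `G`. -/
def IsNested {α : Type*} (M : Matroid α) (G S : Set (Set α)) : Prop :=
  S ⊆ G ∧ ∀ T ⊆ S, T.Nontrivial → IsAntichain (· ⊆ ·) T → M.closure (⋃₀ T) ∉ G

/-! ### The ambient space and the nested set fan -/

/-- The space `N_ℝ = ℝ^α / ℝ (1, …, 1)`. -/
abbrev Ambient (α : Type*) : Type _ := (α → ℝ) ⧸ Submodule.span ℝ {(1 : α → ℝ)}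

/-- The class in `N_ℝ` of a vector of `ℝ^α`. -/
def toAmbient (α : Type*) : (α → ℝ) →ₗ[ℝ] Ambient α :=
  (Submodule.span ℝ {(1 : α → ℝ)}).mkQ

/-- The vector `e_X = ∑_{i ∈ X} e_i`. -/
def incVec {α : Type*} (X : Set α) : α → ℝ := X.indicator 1

/-- The cone `σ_S` in `N_ℝ` consisting of all combinations of the classes of the vectors `e_X`,
`X ∈ S`, with nonnegative coefficients (so `σ_∅ = {0}`). -/
def nestedCone {α : Type*} (S : Set (Set α)) : Set (Ambient α) :=
  (PointedCone.hull ℝ ((fun X => toAmbient α (incVec X)) '' S) : Set (Ambient α))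

/-- The nested set fan of `M` with respect to `G`: the set of all cones `σ_S`, for `S` nested. -/
def nestedFan {α : Type*} (M : Matroid α) (G : Set (Set α)) : Set (Set (Ambient α)) :=
  {σ | ∃ S, IsNested M G S ∧ σ = nestedCone S}

/-! ### The matroid polytope, its faces, and the Bergman fan -/

lemma symm_exchange {α : Type*} (M : Matroid α) {B B' : Set α} (hB : M.IsBase B) (hB' : M.IsBase B') {e : α}
    (he : e ∈ B \ B') :
    ∃ f ∈ B' \ B, M.IsBase (insert f (B \ {e})) ∧ M.IsBase (insert e B' \ {f}) := by
  have heE : e ∈ M.E := hB.subset_ground he.1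
  have hC := hB'.fundCircuit_isCircuit heE he.2
  have hecl := hC.mem_closure_sdiff_singleton_of_mem (M.mem_fundCircuit e B')
  have hnot : ¬ (M.fundCircuit e B' \ {e} ⊆ M.closure (B \ {e})) := fun hsub =>
    hB.indep.notMem_closure_sdiff_of_mem he.1
      (M.closure_subset_closure_of_subset_closure hsub hecl)
  obtain ⟨f, hf, hfcl⟩ := Set.not_subset.1 hnot
  have hfB' : f ∈ B' := (M.fundCircuit_subset_insert e B' hf.1).resolve_left hf.2
  have hfE : f ∈ M.E := hB'.subset_ground hfB'
  have hfB : f ∉ B := fun h => hfcl (M.mem_closure_of_mem' ⟨h, hf.2⟩ hfE)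
  refine ⟨f, ⟨hfB', hfB⟩, hB.exchange_base_of_notMem_closure he.1 hfcl hfE, ?_⟩
  refine hB'.exchange_isBase_of_indep' hfB' he.2 ?_
  rw [← hB'.indep.mem_fundCircuit_iff (by rwa [hB'.closure_eq]) he.2]
  exact hf.1

lemma incVec_exchange {α : Type*} {B B' : Set α} {e f : α} (he : e ∈ B \ B') (hf : f ∈ B' \ B) :
    incVec (insert f (B \ {e})) + incVec (insert e B' \ {f}) = incVec B + incVec B' := by
  classical
  funext i
  have hef : e ≠ f := fun h => hf.2 (h ▸ he.1)
  simp only [incVec, Pi.add_apply, Set.indicator_apply, Set.mem_insert_iff, Set.mem_sdiff,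
    Set.mem_singleton_iff, Pi.one_apply]
  by_cases h1 : i = e
  · subst h1; simp [he.1, he.2, hef]
  by_cases h2 : i = f
  · subst h2; simp [hf.1, hf.2, h1]
  simp [h1, h2]

section Polytope

variable {α : Type*} [Fintype α]

/-- The matroid polytope: the convex hull of the vectors `e_B`, for `B` a base. -/
def matroidPolytope (M : Matroid α) : Set (α → ℝ) :=
  convexHull ℝ (incVec '' {B | M.IsBase B})

/-- The face of the matroid polytope on which the linear functional `u` attains its maximum. -/
def maxFace (M : Matroid α) (u : α → ℝ) : Set (α → ℝ) :=
  {x ∈ matroidPolytope M | ∀ y ∈ matroidPolytope M, dotProduct u y ≤ dotProduct u x}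

lemma incVec_mem_maxFace (M : Matroid α) (u : α → ℝ) {B : Set α} (hB : M.IsBase B) :
    incVec B ∈ maxFace M u ↔
      ∀ B', M.IsBase B' → dotProduct u (incVec B') ≤ dotProduct u (incVec B) := by
  constructor
  · intro h B' hB'
    exact h.2 _ (subset_convexHull ℝ _ ⟨B', hB', rfl⟩)
  · intro h
    refine ⟨subset_convexHull ℝ _ ⟨B, hB, rfl⟩, fun y hy => ?_⟩
    have hconv : Convex ℝ {y : α → ℝ | dotProduct u y ≤ dotProduct u (incVec B)} :=
      convex_halfSpace_le ⟨dotProduct_add u, fun c x => dotProduct_smul c u x⟩ _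
    refine convexHull_min ?_ hconv hy
    rintro _ ⟨B', hB', rfl⟩
    exact h B' hB'

/-- The degeneration of `M` in the direction `u`: the matroid whose bases are the
bases `B` of `M` for which `e_B` lies on the face of the matroid polytope maximizing `u`. -/
def degeneration (M : Matroid α) (u : α → ℝ) : Matroid α :=
  Matroid.ofIsBaseOfFinite (E := M.E) (Set.toFinite _)
    (fun B => M.IsBase B ∧ incVec B ∈ maxFace M u)
    (by
      obtain ⟨B, hB, hmax⟩ := Set.exists_max_image {B | M.IsBase B}
        (fun B => dotProduct u (incVec B)) (Set.toFinite _) M.exists_isBase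
      exact ⟨B, hB, (incVec_mem_maxFace M u hB).2 hmax⟩)
    (by
      rintro B B' ⟨hB, hBm⟩ ⟨hB', hBm'⟩ e he
      obtain ⟨f, hf, h1, h2⟩ := symm_exchange M hB hB' he
      refine ⟨f, hf, h1, (incVec_mem_maxFace M u h1).2 fun A hA => ?_⟩
      have key := congrArg (dotProduct u) (incVec_exchange he hf)
      rw [dotProduct_add, dotProduct_add] at key
      have a1 := (incVec_mem_maxFace M u hB).1 hBm A hA
      have a2 := (incVec_mem_maxFace M u hB').1 hBm' _ h2
      linarith)
    (fun _ hB => hB.1.subset_ground)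

/-- The cone `σ_u` of the outer normal fan of the matroid polytope that has (the class of) `u` in
its relative interior: the classes of all functionals which attain their maximum over the polytope
at every point of the face where `u` does. -/
def normalCone (M : Matroid α) (u : α → ℝ) : Set (Ambient α) :=
  toAmbient α '' {v | maxFace M u ⊆ maxFace M v}

/-- The Bergman fan: the cones `σ_u` of the outer normal fan of the matroid polytope for which the
corresponding degeneration of `M` has no loops. -/
def bergmanFan (M : Matroid α) : Set (Set (Ambient α)) :=
  {σ | ∃ u : α → ℝ, (degeneration M u).Loopless ∧ σ = normalCone M u}

end Polytope

/-- The family of cones `Δ` refines the family of cones `Γ`: every cone of `Δ` lies in a cone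
of `Γ`, and the two families have the same support. -/
def Refines {V : Type*} (Δ Γ : Set (Set V)) : Prop :=
  (∀ σ ∈ Δ, ∃ τ ∈ Γ, σ ⊆ τ) ∧ ⋃₀ Δ = ⋃₀ Γ

end

end BergmanNested

/-! Both inclusions rest on two facts. A weight `v` has a loopless degeneration exactly when all its
superlevel sets are flats (`degeneration_loopless_of_isFlat`, `isFlat_superlevel`). The maximal
members of any subfamily `D` of a nested set are connected components of `M|⋃₀ D`, and `⋃₀ D` is a
flat (`IsNested.eq_component`, `IsNested.isFlat_sUnion`).

Given a nested `S`, weight each element by the number of members of `S` containing it. The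
superlevel sets are unions of members of `S`, hence flats, so the weight defines a Bergman cone.
Each `X ∈ S` is a separator of some superlevel set. A base of maximal weight meets that set in a
basis, hence meets `X` in a basis, hence maximizes `e_X`. So every generator of `σ_S` lies in the
cone.

Conversely, if `v` lies in a Bergman cone, its superlevel sets are flats, and their connected
components form a nested set. Modulo constants `v` is a nonnegative combination of indicators of
superlevel sets, each the sum of the indicators of its components. -/

namespace BergmanNested

open Set

/-! ### Separators and connected components -/

section Separators

variable {α : Type*} {M : Matroid α} {U A X : Set α} {e f : α}

/-- `A` is a separator of `M|U`: each circuit of `M|U` lies in `A` or in its complement. -/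
def IsSeparator (M : Matroid α) (U A : Set α) : Prop :=
  A ⊆ U ∧ ∀ C, M.IsCircuit C → C ⊆ U → C ⊆ A ∨ Disjoint C A

lemma IsSeparator.subset_of_mem (h : IsSeparator M U A) {C : Set α} (hC : M.IsCircuit C)
    (hCU : C ⊆ U) (he : e ∈ C) (heA : e ∈ A) : C ⊆ A :=
  (h.2 C hC hCU).resolve_right fun hd => hd.notMem_of_mem_left he heA

lemma IsSeparator.sdiff (h : IsSeparator M U A) : IsSeparator M U (U \ A) := by
  refine ⟨sdiff_subset, fun C hC hCU => ?_⟩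
  rcases h.2 C hC hCU with h | h
  · exact .inr (disjoint_left.2 fun x hx hx' => hx'.2 (h hx))
  · exact .inl fun x hx => ⟨hCU hx, h.notMem_of_mem_left hx⟩

lemma IsSeparator.restrict (h : IsSeparator M U A) (hX : X ⊆ U) : IsSeparator M X (A ∩ X) := by
  refine ⟨inter_subset_right, fun C hC hCX => ?_⟩
  rcases h.2 C hC (hCX.trans hX) with h | h
  · exact .inl (subset_inter h hCX)
  · exact .inr (h.mono_right inter_subset_left)

lemma IsSeparator.trans (hA : IsSeparator M X A) (hX : IsSeparator M U X) :
    IsSeparator M U A := by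
  refine ⟨hA.1.trans hX.1, fun C hC hCU => ?_⟩
  rcases hX.2 C hC hCU with h | h
  · exact hA.2 C hC h
  · exact .inr (h.mono_right hA.1)

/-- The restriction `M|X` is connected if and only if it has no proper separator. -/
lemma isConnected_restrict_iff (hX : X ⊆ M.E) :
    IsConnected (M.restrict X) ↔ ∀ A, IsSeparator M X A → A.Nonempty → A = X := by
  constructor
  · intro h A hA hne
    by_contra hAX
    have hd : Disjoint (M.restrict A).E (M.restrict (X \ A)).E := disjoint_sdiff_right
    refine h ⟨M.restrict A, M.restrict (X \ A), hd, hne,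
      nonempty_of_ssubset (hA.1.ssubset_of_ne hAX), ?_⟩
    refine Matroid.ext_indep ?_ fun I hI => ?_
    · rw [Matroid.disjointSum_ground_eq]
      exact (union_sdiff_cancel hA.1).symm
    have hIX : I ⊆ X := hI
    rw [Matroid.disjointSum_indep_iff]
    simp only [Matroid.restrict_indep_iff, Matroid.restrict_ground_eq,
      inter_subset_right, and_true, union_sdiff_cancel hA.1, hIX]
    refine ⟨fun h => ⟨h.subset inter_subset_left, h.subset inter_subset_left⟩, fun ⟨h1, h2⟩ => ?_⟩
    rw [Matroid.indep_iff_forall_subset_not_isCircuit (hIX.trans hX)]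
    intro C hCI hC
    rcases hA.2 C hC (hCI.trans hIX) with h | h
    · exact hC.not_indep (h1.subset (subset_inter hCI h))
    · exact hC.not_indep (h2.subset fun x hx => ⟨hCI hx, hIX (hCI hx), h.notMem_of_mem_left hx⟩)
  · rintro h ⟨M₁, M₂, hd, h1, h2, heq⟩
    have hXE : X = M₁.E ∪ M₂.E := by
      have := congrArg Matroid.E heq
      simpa using this
    have hind : ∀ I, M.Indep I ∧ I ⊆ X ↔
        M₁.Indep (I ∩ M₁.E) ∧ M₂.Indep (I ∩ M₂.E) ∧ I ⊆ M₁.E ∪ M₂.E := fun I => by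
      rw [← Matroid.restrict_indep_iff, heq, Matroid.disjointSum_indep_iff]
    have hsep : IsSeparator M X M₁.E := by
      refine ⟨hXE ▸ subset_union_left, fun C hC hCX => ?_⟩
      by_contra! hcon
      obtain ⟨hn1, hn2⟩ := hcon
      obtain ⟨x, hxC, hx1⟩ := not_subset.1 hn1
      obtain ⟨y, hyC, hy1⟩ := not_disjoint_iff.1 hn2
      have hx2 : x ∈ M₂.E := ((hXE ▸ hCX) hxC).resolve_left hx1
      -- Deleting `x` leaves `C ∩ M₁.E` unchanged and deleting `y` leaves `C ∩ M₂.E` unchanged, so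
      -- both traces are independent, and then so is `C`.
      have i1 := (hind (C \ {x})).1 ⟨hC.sdiff_singleton_indep hxC, sdiff_subset.trans hCX⟩
      have i2 := (hind (C \ {y})).1 ⟨hC.sdiff_singleton_indep hyC, sdiff_subset.trans hCX⟩
      refine hC.not_indep ((hind C).2 ⟨i1.1.subset ?_, i2.2.1.subset ?_, hXE ▸ hCX⟩).1
      · rintro z ⟨hz, hz1⟩
        exact ⟨⟨hz, fun h => hx1 (h ▸ hz1)⟩, hz1⟩
      · rintro z ⟨hz, hz2⟩
        exact ⟨⟨hz, fun h => hd.notMem_of_mem_left hy1 (h ▸ hz2)⟩, hz2⟩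
    obtain ⟨z, hz⟩ := h2
    have : z ∈ M₁.E := by rw [h _ hsep h1, hXE]; exact .inr hz
    exact hd.notMem_of_mem_left this hz

/-- The connected component of `e` in `M|U`. -/
def component (M : Matroid α) (U : Set α) (e : α) : Set α :=
  {f ∈ U | ∀ A, IsSeparator M U A → e ∈ A → f ∈ A}

lemma component_subset_separator (hA : IsSeparator M U A) (he : e ∈ A) : component M U e ⊆ A :=
  fun _ hf => hf.2 A hA he

lemma mem_component_self (he : e ∈ U) : e ∈ component M U e := ⟨he, fun _ _ h => h⟩

lemma isSeparator_component (M : Matroid α) (U : Set α) (e : α) :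
    IsSeparator M U (component M U e) := by
  refine ⟨fun _ h => h.1, fun C hC hCU => ?_⟩
  by_contra! hcon
  obtain ⟨hn1, hn2⟩ := hcon
  obtain ⟨x, hxC, hx⟩ := not_subset.1 hn1
  obtain ⟨y, hyC, hy⟩ := not_disjoint_iff.1 hn2
  exact hx ⟨hCU hxC, fun A hA he => hA.subset_of_mem hC hCU hyC (hy.2 A hA he) hxC⟩

lemma component_eq_of_isSeparator (he : e ∈ U) (hA : IsSeparator M U A) (hne : A.Nonempty)
    (hsub : A ⊆ component M U e) : A = component M U e := by
  refine hsub.antisymm ?_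
  by_cases heA : e ∈ A
  · exact component_subset_separator hA heA
  · obtain ⟨x, hx⟩ := hne
    exact absurd hx ((hsub hx).2 _ hA.sdiff ⟨he, heA⟩).2

lemma component_eq_of_mem (he : e ∈ U) (hf : f ∈ component M U e) :
    component M U f = component M U e :=
  component_eq_of_isSeparator he (isSeparator_component M U f) ⟨f, mem_component_self hf.1⟩
    (component_subset_separator (isSeparator_component M U e) hf)

/-- A connected subset of `U` lies in each separator of `M|U` that it meets. -/
lemma subset_separator_of_isConnected (hX : IsConnected (M.restrict X)) (hXE : X ⊆ M.E)
    (hXU : X ⊆ U) (hA : IsSeparator M U A) (he : e ∈ X) (heA : e ∈ A) : X ⊆ A := by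
  have := (isConnected_restrict_iff hXE).1 hX _ (hA.restrict hXU) ⟨e, heA, he⟩
  exact this ▸ inter_subset_left

lemma isConnected_component (hU : U ⊆ M.E) (he : e ∈ U) :
    IsConnected (M.restrict (component M U e)) :=
  (isConnected_restrict_iff fun _ h => hU h.1).2 fun _ hA hne =>
    component_eq_of_isSeparator he (hA.trans (isSeparator_component M U e)) hne hA.1

/-- A circuit putting `e` in the closure of `A` has, by looplessness, a second element, which lies
in `A`; the separator then contains the whole circuit. -/
lemma IsSeparator.isFlat [M.Loopless] (hU : M.IsFlat U) (hA : IsSeparator M U A) :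
    M.IsFlat A := by
  rw [Matroid.isFlat_iff_closure_eq]
  have hAE : A ⊆ M.E := hA.1.trans hU.subset_ground
  refine subset_antisymm (fun e he => ?_) (M.subset_closure A)
  by_contra heA
  obtain ⟨C, hCs, hC, heC⟩ := (Matroid.mem_closure_iff_exists_isCircuit heA).1 he
  have heU : e ∈ U := hU.closure ▸ M.closure_subset_closure hA.1 he
  have hCU : C ⊆ U := hCs.trans (insert_subset heU hA.1)
  obtain ⟨x, hx, hxe⟩ := (Matroid.loopless_iff_forall_isCircuit.1 ‹_› C hC).exists_ne e
  exact heA (hA.subset_of_mem hC hCU hx ((hCs hx).resolve_left hxe) heC)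

lemma component_mem_minBuildingSet [M.Loopless] (hU : M.IsFlat U) (he : e ∈ U) :
    component M U e ∈ minBuildingSet M := by
  refine ⟨(isSeparator_component M U e).isFlat hU, fun h => ?_,
    isConnected_component hU.subset_ground he⟩
  have := mem_component_self (M := M) he
  rw [h, ← Matroid.loops, M.loops_eq_empty] at this
  exact this

lemma IsSeparator.isBasis_inter {B : Set α} (hA : IsSeparator M U A) (hB : M.IsBasis (B ∩ U) U) :
    M.IsBasis (B ∩ A) A := by
  rw [Matroid.isBasis_iff_indep_subset_closure]
  refine ⟨hB.indep.subset (inter_subset_inter_right _ hA.1), inter_subset_right, fun e he => ?_⟩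
  have hAE : A ⊆ M.E := hA.1.trans hB.subset_ground
  by_cases heB : e ∈ B
  · exact M.mem_closure_of_mem' ⟨heB, he⟩ (hAE he)
  obtain ⟨C, hCs, hC, heC⟩ := (Matroid.mem_closure_iff_exists_isCircuit
    (fun h => heB h.1 : e ∉ B ∩ U)).1 (hB.subset_closure (hA.1 he))
  have hCU : C ⊆ U := hCs.trans (insert_subset (hA.1 he) inter_subset_right)
  have hCA := hA.subset_of_mem hC hCU heC he
  refine (Matroid.mem_closure_iff_exists_isCircuit (fun h => heB h.1)).2 ⟨C, fun x hx => ?_, hC, heC⟩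
  exact (hCs hx).imp id fun h => ⟨h.1, hCA hx⟩

end Separators

/-! ### Structure of nested sets -/

section Nested

variable {α : Type*} {M : Matroid α} {S T D : Set (Set α)} {X Y : Set α} {e : α}

lemma nonempty_of_mem_minBuildingSet [M.Loopless] (hX : X ∈ minBuildingSet M) : X.Nonempty := by
  rw [nonempty_iff_ne_empty, ← M.loops_eq_empty]
  exact hX.2.1

/-- Being connected, each member of `T` lies in the component `Y` of `e` or misses it. The closure
of the union of those inside `Y`, together with `W \ Y`, is a flat containing `⋃₀ T`, hence all of
`W`. So the members inside `Y` have join `Y`, which is in the building set; nestedness leaves only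
one such member, namely `X`. -/
lemma IsNested.eq_component [M.Loopless] (hS : IsNested M (minBuildingSet M) S) (hT : T ⊆ S)
    (hanti : IsAntichain (· ⊆ ·) T) (hX : X ∈ T) (he : e ∈ X) :
    X = component M (M.closure (⋃₀ T)) e := by
  set W := M.closure (⋃₀ T) with hW
  set Y := component M W e with hY
  have hTE : ∀ Z ∈ T, Z ⊆ M.E := fun Z hZ => (hS.1 (hT hZ)).1.subset_ground
  have hTW : ⋃₀ T ⊆ W := M.subset_closure _ (sUnion_subset hTE)
  have hsub : ∀ Z ∈ T, Z ⊆ W := fun Z hZ => (subset_sUnion_of_mem hZ).trans hTW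
  have heW : e ∈ W := hsub X hX he
  have hWf : M.IsFlat W := M.isFlat_closure _
  have hYs : IsSeparator M W Y := isSeparator_component M W e
  have hYG : Y ∈ minBuildingSet M := component_mem_minBuildingSet hWf heW
  have hXY : X ⊆ Y := subset_separator_of_isConnected (hS.1 (hT hX)).2.2 (hTE X hX) (hsub X hX)
    hYs he (mem_component_self heW)
  set T' := {Z ∈ T | Z ⊆ Y} with hT'
  have hT'Y : ⋃₀ T' ⊆ Y := sUnion_subset fun Z hZ => hZ.2
  have hZY : M.closure (⋃₀ T') ⊆ Y := hYG.1.closure ▸ M.closure_subset_closure hT'Y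
  have hYE := hYG.1.subset_ground
  have hflat : M.IsFlat (M.closure (⋃₀ T') ∪ (W \ Y)) := by
    rw [Matroid.isFlat_iff_closure_eq]
    have hsubE : M.closure (⋃₀ T') ∪ (W \ Y) ⊆ M.E :=
      union_subset (M.closure_subset_ground _) (sdiff_subset.trans hWf.subset_ground)
    refine subset_antisymm (fun x hx => ?_) (M.subset_closure _ hsubE)
    by_contra hxn
    have hZW : M.closure (⋃₀ T') ∪ (W \ Y) ⊆ W := union_subset (hZY.trans hYs.1) sdiff_subset
    have hxW : x ∈ W := hWf.closure ▸ M.closure_subset_closure hZW hx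
    have hxY : x ∈ Y := by_contra fun h => hxn (.inr ⟨hxW, h⟩)
    obtain ⟨C, hCs, hC, hxC⟩ := (Matroid.mem_closure_iff_exists_isCircuit hxn).1 hx
    have hCY := hYs.subset_of_mem hC (hCs.trans (insert_subset hxW hZW)) hxC hxY
    refine hxn (.inl ?_)
    rw [← M.closure_closure, Matroid.mem_closure_iff_exists_isCircuit fun h => hxn (.inl h)]
    refine ⟨C, fun y hy => (hCs hy).imp id fun h => h.resolve_right fun h' => h'.2 (hCY hy),
      hC, hxC⟩
  have hWsub : W ⊆ M.closure (⋃₀ T') ∪ (W \ Y) := by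
    rw [← hflat.closure]
    refine M.closure_subset_closure (sUnion_subset fun Z hZ => ?_)
    by_cases h : ∃ z ∈ Z, z ∈ Y
    · obtain ⟨z, hz, hzY⟩ := h
      have hZY' : Z ⊆ Y := subset_separator_of_isConnected (hS.1 (hT hZ)).2.2 (hTE Z hZ) (hsub Z hZ)
        hYs hz hzY
      have : Z ⊆ ⋃₀ T' := subset_sUnion_of_mem ⟨hZ, hZY'⟩
      exact (this.trans (M.subset_closure _ (hT'Y.trans hYE))).trans subset_union_left
    · push Not at h
      exact fun z hz => .inr ⟨hsub Z hZ hz, h z hz⟩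
  have hYeq : M.closure (⋃₀ T') = Y := hZY.antisymm fun y hy =>
    (hWsub (hYs.1 hy)).resolve_right fun h => h.2 hy
  have hXT' : X ∈ T' := ⟨hX, hXY⟩
  have hnt : ¬ T'.Nontrivial := fun h => hS.2 T' ((sep_subset _ _).trans hT) h
    (hanti.subset (sep_subset _ _)) (hYeq ▸ hYG)
  rw [not_nontrivial_iff] at hnt
  rw [hnt.eq_singleton_of_mem hXT', sUnion_singleton, (hS.1 (hT hX)).1.closure] at hYeq
  exact hYeq

lemma IsNested.isSeparator [M.Loopless] (hS : IsNested M (minBuildingSet M) S) (hT : T ⊆ S)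
    (hanti : IsAntichain (· ⊆ ·) T) (hX : X ∈ T) : IsSeparator M (M.closure (⋃₀ T)) X := by
  obtain ⟨e, he⟩ := nonempty_of_mem_minBuildingSet (hS.1 (hT hX))
  rw [hS.eq_component hT hanti hX he]
  exact isSeparator_component _ _ _

/-- Members of `T` are whole components of the closure. The component of a point outside `⋃₀ T`
therefore misses them all, and removing it leaves a smaller flat that still contains `⋃₀ T`. -/
lemma IsNested.isFlat_sUnion_of_isAntichain [M.Loopless] (hS : IsNested M (minBuildingSet M) S)
    (hT : T ⊆ S) (hanti : IsAntichain (· ⊆ ·) T) : M.IsFlat (⋃₀ T) := by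
  rw [Matroid.isFlat_iff_closure_eq]
  have hTE : ∀ Z ∈ T, Z ⊆ M.E := fun Z hZ => (hS.1 (hT hZ)).1.subset_ground
  refine subset_antisymm (fun f hf => ?_) (M.subset_closure _ (sUnion_subset hTE))
  by_contra hfT
  set W := M.closure (⋃₀ T) with hW
  have hWf : M.IsFlat W := M.isFlat_closure _
  have hs := isSeparator_component M W f
  have hfl := hs.sdiff.isFlat hWf
  have : W ⊆ W \ component M W f := by
    conv_rhs => rw [← hfl.closure]
    refine M.closure_subset_closure (sUnion_subset fun Z hZ z hz => ⟨?_, fun hzc => ?_⟩)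
    · exact M.subset_closure _ (sUnion_subset hTE) ⟨Z, hZ, hz⟩
    · refine hfT ⟨Z, hZ, ?_⟩
      rw [hS.eq_component hT hanti hZ hz, component_eq_of_mem hf hzc]
      exact mem_component_self hf
  exact (this hf).2 (mem_component_self hf)

/-- Members of a nested set that meet are comparable. -/
lemma IsNested.subset_or_subset [M.Loopless] (hS : IsNested M (minBuildingSet M) S)
    (hX : X ∈ S) (hY : Y ∈ S) (heX : e ∈ X) (heY : e ∈ Y) : X ⊆ Y ∨ Y ⊆ X := by
  by_contra! h
  have hT : ({X, Y} : Set (Set α)) ⊆ S := by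
    rintro Z (rfl | rfl) <;> assumption
  have hanti : IsAntichain (· ⊆ ·) ({X, Y} : Set (Set α)) := by
    rintro Z (rfl | rfl) Z' (rfl | rfl) hne
    exacts [absurd rfl hne, h.1, h.2, absurd rfl hne]
  have h1 := hS.eq_component hT hanti (.inl rfl) heX
  have h2 := hS.eq_component hT hanti (.inr rfl) heY
  exact h.1 (h1.trans h2.symm).subset

lemma sUnion_maximal [Finite α] (D : Set (Set α)) : ⋃₀ {X | Maximal (· ∈ D) X} = ⋃₀ D := by
  refine subset_antisymm (sUnion_mono fun X hX => hX.prop) (sUnion_subset fun X hX => ?_)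
  obtain ⟨Y, hXY, hY⟩ := (toFinite D).exists_le_maximal hX
  exact hXY.trans (subset_sUnion_of_mem hY)

lemma isAntichain_maximal (D : Set (Set α)) : IsAntichain (· ⊆ ·) {X | Maximal (· ∈ D) X} :=
  fun _ hX _ hY hne h => hne (hX.eq_of_subset hY.prop h)

lemma IsNested.isFlat_sUnion [Finite α] [M.Loopless] (hS : IsNested M (minBuildingSet M) S)
    (hD : D ⊆ S) : M.IsFlat (⋃₀ D) := by
  rw [← sUnion_maximal]
  exact hS.isFlat_sUnion_of_isAntichain (fun X hX => hD hX.prop) (isAntichain_maximal D)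

lemma IsNested.isSeparator_sUnion [Finite α] [M.Loopless]
    (hS : IsNested M (minBuildingSet M) S) (hD : D ⊆ S) (hX : Maximal (· ∈ D) X) :
    IsSeparator M (⋃₀ D) X := by
  have := hS.isSeparator (fun X hX => hD hX.prop) (isAntichain_maximal D) hX
  rwa [sUnion_maximal, (hS.isFlat_sUnion hD).closure] at this

end Nested

/-! ### Bases of maximal weight -/

section Weight

variable {α : Type*} [Fintype α] {M : Matroid α} {u v w : α → ℝ} {B : Set α} {i f : α}

omit [Fintype α] in
lemma isBase_exchange_fundCircuit (hB : M.IsBase B) (hi : i ∈ M.E) (hiB : i ∉ B)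
    (hf : f ∈ M.fundCircuit i B) (hfi : f ≠ i) : M.IsBase (insert i B \ {f}) := by
  have hfB : f ∈ B := (M.fundCircuit_subset_insert i B hf).resolve_left hfi
  refine hB.exchange_isBase_of_indep' hfB hiB ?_
  rwa [← hB.indep.mem_fundCircuit_iff (by rwa [hB.closure_eq]) hiB]

lemma dotProduct_incVec_exchange (v : α → ℝ) (hiB : i ∉ B) (hfB : f ∈ B) :
    dotProduct v (incVec (insert i B \ {f})) = dotProduct v (incVec B) + v i - v f := by
  classical
  have : incVec (insert i B \ {f}) = incVec B + Pi.single i 1 - Pi.single f 1 := by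
    have hif : i ≠ f := fun h => hiB (h ▸ hfB)
    funext j
    simp only [incVec, indicator_apply, mem_sdiff, mem_insert_iff, mem_singleton_iff,
      Pi.add_apply, Pi.sub_apply, Pi.single_apply, Pi.one_apply]
    by_cases h1 : j = i
    · subst h1; simp [hiB, hif]
    by_cases h2 : j = f
    · subst h2; simp [hfB, h1]
    simp [h1, h2]
  rw [this, dotProduct_sub, dotProduct_add]
  simp

lemma dotProduct_incVec_incVec (X B : Set α) :
    dotProduct (incVec X) (incVec B) = ((B ∩ X).ncard : ℝ) := by
  classical
  simp only [dotProduct, incVec]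
  rw [ncard_eq_toFinset_card' (B ∩ X)]
  simp only [indicator_apply, Pi.one_apply, mul_ite, mul_one, mul_zero, ← ite_and,
    Finset.sum_boole, Nat.cast_inj]
  congr 1
  ext
  simp

/-- A base of maximal weight meets each superlevel set of the weight in a basis. -/
lemma isBasis_inter_superlevel (hE : M.E = univ) (hB : M.IsBase B)
    (hmax : incVec B ∈ maxFace M v) (t : ℝ) :
    M.IsBasis (B ∩ {j | t ≤ v j}) {j | t ≤ v j} := by
  rw [Matroid.isBasis_iff_indep_subset_closure]
  refine ⟨hB.indep.subset inter_subset_left, inter_subset_right, fun e (he : t ≤ v e) => ?_⟩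
  have heE : e ∈ M.E := hE ▸ mem_univ e
  by_cases heB : e ∈ B
  · exact M.mem_closure_of_mem' ⟨heB, he⟩ heE
  refine (Matroid.mem_closure_iff_exists_isCircuit fun h => heB h.1).2 ⟨M.fundCircuit e B, ?_,
    hB.fundCircuit_isCircuit heE heB, M.mem_fundCircuit e B⟩
  intro f hf
  by_cases hfe : f = e
  · exact .inl hfe
  have hfB : f ∈ B := (M.fundCircuit_subset_insert e B hf).resolve_left hfe
  refine .inr ⟨hfB, ?_⟩
  have := (incVec_mem_maxFace M v hB).1 hmax _ (isBase_exchange_fundCircuit hB heE heB hf hfe)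
  rw [dotProduct_incVec_exchange v heB hfB] at this
  simp only [mem_ofPred_eq]
  linarith

lemma isBase_degeneration_iff :
    (degeneration M u).IsBase B ↔ M.IsBase B ∧ incVec B ∈ maxFace M u := Iff.rfl

lemma degeneration_loopless_iff (hE : M.E = univ) : (degeneration M u).Loopless ↔
    ∀ i, ∃ B, M.IsBase B ∧ incVec B ∈ maxFace M u ∧ i ∈ B := by
  rw [Matroid.loopless_iff_forall_isNonloop]
  refine ⟨fun h i => ?_, fun h i _ => ?_⟩
  · obtain ⟨B, hB, hi⟩ := (h i (by change i ∈ M.E; simp [hE])).exists_mem_isBase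
    exact ⟨B, hB.1, hB.2, hi⟩
  · obtain ⟨B, hB, hBm, hi⟩ := h i
    exact (isBase_degeneration_iff.2 ⟨hB, hBm⟩).indep.isNonloop_of_mem hi

lemma exists_isBase_mem_maxFace (M : Matroid α) (u : α → ℝ) :
    ∃ B, M.IsBase B ∧ incVec B ∈ maxFace M u := by
  obtain ⟨B, hB⟩ := (degeneration M u).exists_isBase
  exact ⟨B, hB⟩

/-- If the superlevel sets of `v` are flats of a loopless matroid, the degeneration in the
direction `v` is loopless. -/
lemma degeneration_loopless_of_isFlat [M.Loopless] (hE : M.E = univ)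
    (hv : ∀ t : ℝ, M.IsFlat {j | t ≤ v j}) : (degeneration M v).Loopless := by
  refine (degeneration_loopless_iff hE).2 fun i => ?_
  obtain ⟨B, hB, hBm⟩ := exists_isBase_mem_maxFace M v
  by_cases hiB : i ∈ B
  · exact ⟨B, hB, hBm, hiB⟩
  have hiE : i ∈ M.E := hE ▸ mem_univ i
  have hC := hB.fundCircuit_isCircuit hiE hiB
  obtain ⟨g, hg, hgi⟩ := (Matroid.loopless_iff_forall_isCircuit.1 ‹_› _ hC).exists_ne i
  -- With `f` of least weight, the rest of the circuit lies in the flat `{j | v f ≤ v j}`, hence so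
  -- does `i`: exchanging `f` for `i` loses no weight.
  obtain ⟨f, hf, hmin⟩ := exists_min_image (M.fundCircuit i B \ {i}) v (toFinite _) ⟨g, hg, hgi⟩
  have hfB : f ∈ B := (M.fundCircuit_subset_insert i B hf.1).resolve_left hf.2
  have hle : v f ≤ v i := by
    have h1 := hC.mem_closure_sdiff_singleton_of_mem (M.mem_fundCircuit i B)
    have h2 := M.closure_subset_closure (show _ ⊆ {j | v f ≤ v j} from hmin) h1
    rwa [(hv (v f)).closure] at h2
  have hB' := isBase_exchange_fundCircuit hB hiE hiB hf.1 hf.2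
  refine ⟨_, hB', (incVec_mem_maxFace M v hB').2 fun A hA => ?_, .inl rfl, fun h => hf.2 h.symm⟩
  have := (incVec_mem_maxFace M v hB).1 hBm A hA
  rw [dotProduct_incVec_exchange v hiB hfB]
  linarith

/-- If each element lies in a base of maximal weight, then the superlevel sets of the weight
are flats. -/
lemma isFlat_superlevel (hE : M.E = univ)
    (h : ∀ i, ∃ B, M.IsBase B ∧ incVec B ∈ maxFace M v ∧ i ∈ B) (t : ℝ) :
    M.IsFlat {j | t ≤ v j} := by
  rw [Matroid.isFlat_iff_closure_eq]
  refine subset_antisymm (fun e he => ?_) (M.subset_closure _ (by simp [hE]))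
  -- Since `B` contains `e`, a circuit witnessing `e` in the closure of `B ∩ {j | t ≤ v j}` would
  -- lie inside `B`.
  obtain ⟨B, hB, hBm, heB⟩ := h e
  have hbas := isBasis_inter_superlevel hE hB hBm t
  rw [← hbas.closure_eq_closure] at he
  by_contra het
  obtain ⟨C, hCs, hC, -⟩ := (Matroid.mem_closure_iff_exists_isCircuit fun h => het h.2).1 he
  exact hC.not_indep (hB.indep.subset (hCs.trans (insert_subset heB inter_subset_left)))

/-- Inclusion of faces of the matroid polytope can be tested on vertices. -/
lemma maxFace_subset_maxFace
    (h : ∀ B, M.IsBase B → incVec B ∈ maxFace M u → incVec B ∈ maxFace M v) :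
    maxFace M u ⊆ maxFace M v := by
  intro x hx
  obtain ⟨B₀, hB₀, hu₀⟩ := exists_isBase_mem_maxFace M u
  have hv₀ := h B₀ hB₀ hu₀
  -- For large `N` the functional `N • u - v` is maximal at `B₀` among the finitely many bases:
  -- those with smaller `u`-value are beaten by the factor `N`, and those with equal `u`-value are
  -- `v`-maximal by `h`.
  obtain ⟨N, hN⟩ : ∃ N : ℝ, ∀ B, M.IsBase B →
      dotProduct v (incVec B₀) - dotProduct v (incVec B) ≤
        N * (dotProduct u (incVec B₀) - dotProduct u (incVec B)) := by
    have : ∀ B : Set α, ∀ᶠ N : ℝ in Filter.atTop, M.IsBase B →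
        dotProduct v (incVec B₀) - dotProduct v (incVec B) ≤
          N * (dotProduct u (incVec B₀) - dotProduct u (incVec B)) := by
      intro B
      by_cases hB : M.IsBase B
      swap
      · simp [hB]
      have hle := (incVec_mem_maxFace M u hB₀).1 hu₀ B hB
      rcases hle.eq_or_lt with heq | hlt
      · have hBu : incVec B ∈ maxFace M u := (incVec_mem_maxFace M u hB).2 fun A hA =>
          heq ▸ (incVec_mem_maxFace M u hB₀).1 hu₀ A hA
        have := (incVec_mem_maxFace M v hB).1 (h B hB hBu) B₀ hB₀
        exact .of_forall fun N _ => by rw [heq]; linarith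
      · have hpos := sub_pos.2 hlt
        filter_upwards [Filter.eventually_ge_atTop ((dotProduct v (incVec B₀) -
          dotProduct v (incVec B)) / (dotProduct u (incVec B₀) - dotProduct u (incVec B)))]
          with N hN _
        exact (div_le_iff₀ hpos).1 hN
    obtain ⟨N, hN⟩ := (Filter.eventually_all.2 this).exists
    exact ⟨N, hN⟩
  have hconv : Convex ℝ {y : α → ℝ | dotProduct (N • u - v) y ≤
      N * dotProduct u (incVec B₀) - dotProduct v (incVec B₀)} :=
    convex_halfSpace_le ⟨dotProduct_add _, fun c x => dotProduct_smul c _ x⟩ _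
  have hxle : dotProduct (N • u - v) x ≤
      N * dotProduct u (incVec B₀) - dotProduct v (incVec B₀) := by
    refine convexHull_min ?_ hconv hx.1
    rintro _ ⟨B, hB, rfl⟩
    have := hN B hB
    simp only [mem_ofPred_eq, sub_dotProduct, smul_dotProduct, smul_eq_mul]
    linarith
  have hux : dotProduct u x = dotProduct u (incVec B₀) :=
    (hu₀.2 x hx.1).antisymm (hx.2 _ hu₀.1)
  rw [sub_dotProduct, smul_dotProduct, smul_eq_mul, hux] at hxle
  exact ⟨hx.1, fun y hy => (hv₀.2 y hy).trans (by linarith)⟩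

lemma maxFace_zero (M : Matroid α) : maxFace M 0 = matroidPolytope M := by
  simp [maxFace]

lemma maxFace_inter_subset_add : maxFace M v ∩ maxFace M w ⊆ maxFace M (v + w) := by
  rintro x ⟨hv, hw⟩
  refine ⟨hv.1, fun y hy => ?_⟩
  rw [add_dotProduct, add_dotProduct]
  exact add_le_add (hv.2 y hy) (hw.2 y hy)

lemma maxFace_subset_smul {c : ℝ} (hc : 0 ≤ c) : maxFace M v ⊆ maxFace M (c • v) := by
  refine fun x hx => ⟨hx.1, fun y hy => ?_⟩
  rw [smul_dotProduct, smul_dotProduct]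
  exact mul_le_mul_of_nonneg_left (hx.2 y hy) hc

/-- A base meeting `X` in a basis of `X` lies on the face maximizing `e_X`. -/
lemma incVec_mem_maxFace_incVec {X : Set α} (hB : M.IsBase B) (hBX : M.IsBasis (B ∩ X) X) :
    incVec B ∈ maxFace M (incVec X) := by
  refine (incVec_mem_maxFace M _ hB).2 fun A hA => ?_
  rw [dotProduct_incVec_incVec, dotProduct_incVec_incVec, Nat.cast_le]
  obtain ⟨J, hJ, hAJ⟩ := (hA.indep.subset (inter_subset_left (t := X))).subset_isBasis_of_subset
    inter_subset_right hBX.subset_ground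
  calc (A ∩ X).ncard ≤ J.ncard := ncard_le_ncard hAJ (toFinite _)
    _ = (B ∩ X).ncard := by rw [ncard_def, ncard_def, hJ.encard_eq_encard hBX]

end Weight

/-! ### Cones of the nested set fan lie in cones of the Bergman fan -/

section NestedToBergman

variable {α : Type*} [Fintype α] {M : Matroid α} {S : Set (Set α)} {X : Set α}

/-- The weight counting the members of `S` that contain an element. -/
noncomputable def depthWeight (S : Set (Set α)) (i : α) : ℝ := ({X ∈ S | i ∈ X}.ncard : ℝ)

/-- The members of `S` containing `i` form a chain, nonempty when the weight is positive. They are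
exactly the members containing its least element. -/
lemma IsNested.superlevel_depthWeight [M.Loopless] (hS : IsNested M (minBuildingSet M) S)
    {t : ℝ} (ht : 0 < t) :
    {i | t ≤ depthWeight S i} = ⋃₀ {X ∈ S | t ≤ ({Y ∈ S | X ⊆ Y}.ncard : ℝ)} := by
  ext i
  simp only [mem_ofPred_eq, mem_sUnion, depthWeight]
  constructor
  · intro h
    have hpos : 0 < {X ∈ S | i ∈ X}.ncard := by exact_mod_cast ht.trans_le h
    obtain ⟨X, hX⟩ := (toFinite {X ∈ S | i ∈ X}).exists_minimal ((ncard_pos).1 hpos)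
    refine ⟨X, ⟨hX.prop.1, ?_⟩, hX.prop.2⟩
    have : {Y ∈ S | X ⊆ Y} = {Y ∈ S | i ∈ Y} := by
      ext Y
      refine and_congr_right fun hY => ⟨fun h => h hX.prop.2, fun hi => ?_⟩
      rcases hS.subset_or_subset hX.prop.1 hY hX.prop.2 hi with h | h
      · exact h
      · exact hX.le_of_le ⟨hY, hi⟩ h
    rwa [this]
  · rintro ⟨X, ⟨hX, htX⟩, hi⟩
    refine htX.trans (Nat.cast_le.2 (ncard_le_ncard ?_ (toFinite _)))
    exact fun Y hY => ⟨hY.1, hY.2 hi⟩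

lemma IsNested.isFlat_superlevel_depthWeight [M.Loopless] (hE : M.E = univ)
    (hS : IsNested M (minBuildingSet M) S) (t : ℝ) : M.IsFlat {i | t ≤ depthWeight S i} := by
  rcases le_or_gt t 0 with ht | ht
  · have : {i | t ≤ depthWeight S i} = M.E := by
      rw [hE, eq_univ_iff_forall]
      exact fun i => ht.trans (Nat.cast_nonneg _)
    rw [this]
    exact M.ground_isFlat
  · rw [hS.superlevel_depthWeight ht]
    exact hS.isFlat_sUnion (sep_subset _ _)

/-- The threshold is the number of members containing `X`. Strictly larger members have fewer
members above them, so `X` is maximal among those reaching it. -/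
lemma IsNested.exists_isSeparator_superlevel [M.Loopless] (hS : IsNested M (minBuildingSet M) S)
    (hX : X ∈ S) : ∃ t : ℝ, IsSeparator M {i | t ≤ depthWeight S i} X := by
  have hpos : 0 < {Y ∈ S | X ⊆ Y}.ncard := (ncard_pos).2 ⟨X, hX, Subset.rfl⟩
  refine ⟨({Y ∈ S | X ⊆ Y}.ncard : ℝ), ?_⟩
  rw [hS.superlevel_depthWeight (Nat.cast_pos.2 hpos)]
  refine hS.isSeparator_sUnion (sep_subset _ _) ⟨⟨hX, le_rfl⟩, fun Y hY hXY => ?_⟩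
  by_contra hYX
  refine (Nat.cast_le.1 hY.2).not_gt (ncard_lt_ncard ?_ (toFinite _))
  exact ⟨fun Z hZ => ⟨hZ.1, hXY.trans hZ.2⟩, fun h => hYX (h ⟨hX, Subset.rfl⟩).2⟩

lemma IsNested.nestedCone_subset_normalCone [M.Loopless] (hE : M.E = univ)
    (hS : IsNested M (minBuildingSet M) S) :
    nestedCone S ⊆ normalCone M (depthWeight S) := by
  intro x hx
  refine Submodule.span_induction (p := fun x _ => x ∈ normalCone M (depthWeight S))
    ?_ ?_ ?_ ?_ hx
  · rintro _ ⟨X, hX, rfl⟩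
    refine ⟨incVec X, maxFace_subset_maxFace fun B hB hBm => ?_, rfl⟩
    obtain ⟨t, ht⟩ := hS.exists_isSeparator_superlevel hX
    exact incVec_mem_maxFace_incVec hB (ht.isBasis_inter (isBasis_inter_superlevel hE hB hBm t))
  · refine ⟨0, fun x hx => ?_, map_zero _⟩
    rw [maxFace_zero]
    exact hx.1
  · rintro _ _ - - ⟨v, hv, rfl⟩ ⟨w, hw, rfl⟩
    exact ⟨v + w, fun x hx => maxFace_inter_subset_add ⟨hv hx, hw hx⟩, map_add _ _ _⟩
  · rintro c _ - ⟨v, hv, rfl⟩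
    exact ⟨(c : ℝ) • v, hv.trans (maxFace_subset_smul c.2), map_smul _ _ _⟩

end NestedToBergman

/-! ### The Bergman fan is covered by the nested set fan -/

section BergmanToNested

variable {α : Type*} [Fintype α] {M : Matroid α} {v : α → ℝ}

/-- The connected components of the restrictions of `M` to the superlevel sets of `v`. -/
def levelComponents (M : Matroid α) (v : α → ℝ) : Set (Set α) :=
  {X | ∃ t : ℝ, ∃ e, t ≤ v e ∧ X = component M {j | t ≤ v j} e}

/-- In an antichain `T`, let `Y` have the lowest threshold. Every member lies in that superlevel
set, of which `Y` is a separator. A connected join would meet `Y` and so lie in it, forcing the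
other members into `Y`. -/
lemma isNested_levelComponents [M.Loopless] (hv : ∀ t : ℝ, M.IsFlat {j | t ≤ v j}) :
    IsNested M (minBuildingSet M) (levelComponents M v) := by
  refine ⟨?_, fun T hT hnt hanti hcl => ?_⟩
  · rintro _ ⟨t, e, he, rfl⟩
    exact component_mem_minBuildingSet (hv t) he
  have : Nonempty α := by
    obtain ⟨X, hX⟩ := hnt.nonempty
    exact ⟨(hT hX).choose_spec.choose⟩
  have hT' : ∀ X ∈ T, ∃ t : ℝ, ∃ e, t ≤ v e ∧ X = component M {j | t ≤ v j} e := hT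
  choose! t e he hX using hT'
  obtain ⟨Y, hYT, hmin⟩ := exists_min_image T t (toFinite _) hnt.nonempty
  obtain ⟨Z, hZT, hZY⟩ := hnt.exists_ne Y
  set U := {j | t Y ≤ v j} with hU
  have hsub : ∀ X ∈ T, X ⊆ U := fun X hXT => by
    rw [hX X hXT]
    intro j hj
    exact (hmin X hXT).trans hj.1
  have hTU : ⋃₀ T ⊆ U := sUnion_subset hsub
  have hclU : M.closure (⋃₀ T) ⊆ U :=
    (M.closure_subset_closure hTU).trans (hv (t Y)).closure.subset
  have hYsep : IsSeparator M U Y := by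
    have := isSeparator_component M U (e Y)
    rwa [← hX Y hYT] at this
  have hself : ∀ X ∈ T, e X ∈ X := fun X hXT => by
    have := mem_component_self (M := M) (U := {j | t X ≤ v j}) (he X hXT)
    rwa [← hX X hXT] at this
  have hin : ∀ X ∈ T, X ⊆ M.closure (⋃₀ T) := fun X hXT =>
    (subset_sUnion_of_mem hXT).trans
      (M.subset_closure _ (hTU.trans (hv (t Y)).subset_ground))
  have := subset_separator_of_isConnected hcl.2.2 hcl.1.subset_ground hclU hYsep
    (hin Y hYT (hself Y hYT)) (hself Y hYT)
  exact hanti hZT hYT hZY ((hin Z hZT).trans this)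

/-- The vector `e_U` is the sum of the vectors of the connected components of `M|U`. -/
lemma toAmbient_incVec_mem_hull (M : Matroid α) {S : Set (Set α)} (U : Set α)
    (h : ∀ e ∈ U, component M U e ∈ S) :
    toAmbient α (incVec U) ∈
      PointedCone.hull ℝ ((fun X => toAmbient α (incVec X)) '' S) := by
  classical
  have hsum : incVec U = ∑ X ∈ (component M U '' U).toFinset, incVec X := by
    funext i
    rw [Finset.sum_apply]
    by_cases hi : i ∈ U
    · rw [Finset.sum_eq_single (component M U i)]
      · simp [incVec, hi, mem_component_self hi]
      · intro X hX hne
        rw [mem_toFinset] at hX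
        obtain ⟨e, he, rfl⟩ := hX
        refine indicator_of_notMem (fun hie => hne ?_) _
        exact (component_eq_of_mem he hie).symm
      · exact fun hn => absurd (mem_toFinset.2 (mem_image_of_mem _ hi)) hn
    · rw [Finset.sum_eq_zero]
      · exact indicator_of_notMem hi _
      · intro X hX
        rw [mem_toFinset] at hX
        obtain ⟨e, he, rfl⟩ := hX
        exact indicator_of_notMem (fun hie => hi hie.1) _
  rw [hsum, map_sum]
  refine Submodule.sum_mem _ fun X hX => ?_
  rw [mem_toFinset] at hX
  obtain ⟨e, he, rfl⟩ := hX
  exact Submodule.subset_span ⟨_, h e he, rfl⟩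

omit [Fintype α] in
lemma toAmbient_const (c : ℝ) : toAmbient α (fun _ => c) = 0 := by
  refine (Submodule.Quotient.mk_eq_zero _).2 (Submodule.mem_span_singleton.2 ⟨c, ?_⟩)
  funext i
  simp

/-- A vector is a nonnegative combination of the indicators of its superlevel sets, modulo
constants. -/
lemma toAmbient_mem_of_superlevel (K : PointedCone ℝ (Ambient α)) (v : α → ℝ)
    (h : ∀ t, toAmbient α (incVec {j | t ≤ v j}) ∈ K) : toAmbient α v ∈ K := by
  -- Truncate `v` at its successive values: the lowest truncation is constant, and passing from a
  -- value `r` to the next value `s` adds `s - r` times the indicator of `{j | s ≤ v j}`.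
  have key : ∀ s : range v, toAmbient α (fun j => min (v j) s) ∈ K := by
    intro s
    induction s using WellFoundedLT.induction with
    | ind s ih =>
      by_cases hs : ∃ r : range v, r < s
      · obtain ⟨r, hr, hmax⟩ := exists_max_image {r : range v | r < s} id (toFinite _) hs
        have hrs : (r : ℝ) < s := hr
        have heq : (fun j => min (v j) s) =
            (fun j => min (v j) r) + ((s : ℝ) - r) • incVec {j | (s : ℝ) ≤ v j} := by
          funext j
          by_cases hj : (s : ℝ) ≤ v j
          · simp [incVec, hj, min_eq_right (hrs.le.trans hj)]
          · have hjr : v j ≤ r := hmax ⟨v j, j, rfl⟩ (not_le.1 hj)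
            simp [incVec, hj, hjr, (not_le.1 hj).le]
        rw [heq, map_add, map_smul]
        exact K.add_mem (ih r hr) (K.smul_mem (sub_pos.2 hrs).le (h s))
      · push Not at hs
        have : (fun j => min (v j) (s : ℝ)) = fun _ => (s : ℝ) :=
          funext fun j => min_eq_right (hs ⟨v j, j, rfl⟩)
        rw [this, toAmbient_const]
        exact K.zero_mem
  rcases isEmpty_or_nonempty α with hα | hα
  · rw [Subsingleton.elim v fun _ => 0, toAmbient_const]
    exact K.zero_mem
  · obtain ⟨i, hi⟩ := Finite.exists_max v
    have := key ⟨v i, i, rfl⟩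
    simpa only [min_eq_left (hi _)] using this

lemma toAmbient_mem_nestedCone_levelComponents (M : Matroid α) (v : α → ℝ) :
    toAmbient α v ∈ nestedCone (levelComponents M v) :=
  toAmbient_mem_of_superlevel _ v fun t =>
    toAmbient_incVec_mem_hull M _ fun e he => ⟨t, e, he, rfl⟩

end BergmanToNested

end BergmanNested

theorem mainTheorem1 {α : Type*} [Fintype α] (M : Matroid α) (hE : M.E = Set.univ)
    (hM : M.Loopless) :
    BergmanNested.Refines
      (BergmanNested.nestedFan M (BergmanNested.minBuildingSet M))
      (BergmanNested.bergmanFan M) := by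
  open BergmanNested in
  have hsub : ∀ σ ∈ nestedFan M (minBuildingSet M), ∃ τ ∈ bergmanFan M, σ ⊆ τ := by
    rintro _ ⟨S, hS, rfl⟩
    exact ⟨_, ⟨depthWeight S, degeneration_loopless_of_isFlat hE
      (hS.isFlat_superlevel_depthWeight hE), rfl⟩, hS.nestedCone_subset_normalCone hE⟩
  refine ⟨hsub, Set.Subset.antisymm ?_ ?_⟩
  · rintro x ⟨σ, hσ, hx⟩
    obtain ⟨τ, hτ, hle⟩ := hsub σ hσ
    exact ⟨τ, hτ, hle hx⟩
  · rintro _ ⟨_, ⟨u, hu, rfl⟩, v, hv, rfl⟩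
    -- The point `v` may lie on the boundary of the cone of `u`, but `u`-maximal bases are also
    -- `v`-maximal, so the superlevel sets of `v` itself are flats.
    have hflat := BergmanNested.isFlat_superlevel (v := v) hE fun i => by
      obtain ⟨B, hB, hBm, hi⟩ := (BergmanNested.degeneration_loopless_iff hE).1 hu i
      exact ⟨B, hB, hv hBm, hi⟩
    exact ⟨_, ⟨_, BergmanNested.isNested_levelComponents hflat, rfl⟩,
      BergmanNested.toAmbient_mem_nestedCone_levelComponents M v⟩
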